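/- All rings are commutative. For a ring $R$, an $R$-module is \emph{almost projective} if it is a direct summand of a module of the form $P\oplus F$ with $P$ projective and $F$ finitely generated. Let $X$ be a quasi-compact semi-separated scheme (that is, the diagonal of $X$ is affine), and let $U_0,\dots,U_n$ be affine open subsets covering $X$. Let $Q_X$ be the quiver whose vertices are the non-empty subsets $v\subseteq\{0,\dots,n\}$, with a unique arrow $v\to w$ whenever $v\subseteq w$, and let $\mathbf R$ be its representation $R(v)=\mathcal O_X\bigl(\bigcap_{k\in v}U_k\bigr)$, with the restriction maps. An $\mathbf R$-module $\mathbf M$ consists of an $R(v)$-module $M(v)$ for every vertex $v$ and an $R(v)$-linear map $M(v)\to M(w)$ for every arrow $v\to w$. It is \emph{quasi-coherent} if for every arrow $v\to w$ the induced map $R(w)\otimes_{R(v)}M(v)\to M(w)$ is an isomorphism; quasi-coherent sheaves on $X$ correspond to those quasi-coherent $\mathbf R$-modules whose maps are compatible with identities and compositions of arrows. We call $\mathbf M$ \emph{locally almost projective} (respectively \emph{locally countably generated}) if every $M(v)$ is an almost projective (respectively countably generated) $R(v)$-module. Submodules, unions and quotients of $\mathbf R$-modules are formed at each vertex. Let $\mathbf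 M$ be a locally almost projective quasi-coherent $\mathbf R$-module. Then there are an ordinal $\mu$ and an increasing chain $(\mathbf M_\alpha : \alpha\le\mu)$ of quasi-coherent submodules of $\mathbf M$ such that $\mathbf M_0=0$, $\mathbf M_\mu=\mathbf M$, $\mathbf M_\alpha=\bigcup_{\beta<\alpha}\mathbf M_\beta$ for every limit ordinal $\alpha\le\mu$, and for every $\alpha<\mu$ the quotient $\mathbf M_{\alpha+1}/\mathbf M_\alpha$ is a locally countably generated, locally almost projective quasi-coherent $\mathbf R$-module. Moreover, if the maps of $\mathbf M$ are compatible with identities and compositions of arrows (so that $\mathbf M$ corresponds to a quasi-coherent sheaf on $X$), then so are those of all the $\mathbf M_\alpha$ and of all the quotients $\mathbf M_{\alpha+1}/\mathbf M_\alpha$. -/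

import Mathlib

open CategoryTheory

universe u

section Modules

variable (R : Type u) [CommRing R] (M : Type u) [AddCommGroup M] [Module R M]

/-- A module isomorphic to a direct sum of a projective module and a finitely generated one. -/
def IsElementaryAlmostProjective : Prop :=
  ∃ (P F : Type u) (_ : AddCommGroup P) (_ : Module R P) (_ : AddCommGroup F) (_ : Module R F),
    Module.Projective R P ∧ Module.Finite R F ∧ Nonempty (M ≃ₗ[R] P × F)

/-- A direct summand of an elementary almost projective module. -/
def IsAlmostProjective : Prop :=
  ∃ (E K : Type u) (_ : AddCommGroup E) (_ : Module R E) (_ : AddCommGroup K) (_ : Module R K),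
    IsElementaryAlmostProjective R E ∧ Nonempty (E ≃ₗ[R] M × K)

/-- A module generated by a countable (possibly finite) set. -/
def IsCountablyGeneratedModule : Prop :=
  ∃ s : Set M, s.Countable ∧ Submodule.span R s = ⊤

end Modules

/-- A module over a representation `R` of a quiver `V` in commutative rings: an `R(v)`-module
for every vertex `v`, and for every edge `a : v ⟶ w` an `R(v)`-linear map `M(v) → M(w)`
(a map that is semilinear along `R(a)`). -/
structure QuiverModule {V : Type*} [Quiver V] (R : V ⥤q CommRingCat.{u}) where
  /-- the module at a vertex -/
  obj (v : V) : ModuleCat.{u} (R.obj v)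
  /-- the map along an edge -/
  map {v w : V} (a : v ⟶ w) : obj v →ₛₗ[(R.map a).hom] obj w

namespace QuiverModule

section Quiver

variable {V : Type*} [Quiver V] {R : V ⥤q CommRingCat.{u}}

/-- For every edge `a : v ⟶ w` the `R(w)`-linear map `R(w) ⊗_{R(v)} M(v) → M(w)`,
`r ⊗ m ↦ r • M(a)(m)`, is bijective. -/
def IsQuasicoherent (M : QuiverModule R) : Prop :=
  ∀ ⦃v w : V⦄ (a : v ⟶ w),
    letI : Algebra (R.obj v) (R.obj w) := (R.map a).hom.toAlgebra
    letI : Module (R.obj v) (M.obj w) := Module.compHom (M.obj w) (R.map a).hom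
    haveI : IsScalarTower (R.obj v) (R.obj w) (M.obj w) :=
      IsScalarTower.of_algebraMap_smul fun _ _ => rfl
    IsBaseChange (R.obj w)
      ({ toFun := M.map a
         map_add' := (M.map a).map_add
         map_smul' := (M.map a).map_smulₛₗ } : M.obj v →ₗ[R.obj v] M.obj w)

/-- `M(v)` is an almost projective `R(v)`-module for every vertex `v`. -/
def IsLocallyAlmostProjective (M : QuiverModule R) : Prop :=
  ∀ v : V, IsAlmostProjective (R.obj v) (M.obj v)

/-- `M(v)` is a countably generated `R(v)`-module for every vertex `v`. -/
def IsLocallyCountablyGenerated (M : QuiverModule R) : Prop :=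
  ∀ v : V, IsCountablyGeneratedModule (R.obj v) (M.obj v)

/-- A submodule of a module over a representation of a quiver: a submodule at every vertex,
stable under the maps along the edges. -/
structure Sub (M : QuiverModule R) where
  /-- the submodule at a vertex -/
  carrier (v : V) : Submodule (R.obj v) (M.obj v)
  map_mem {v w : V} (a : v ⟶ w) : ∀ m ∈ carrier v, M.map a m ∈ carrier w

namespace Sub

variable {M : QuiverModule R}

/-- A submodule, as a module over the representation. -/
def toQuiverModule (A : M.Sub) : QuiverModule R where
  obj v := ModuleCat.of (R.obj v) (A.carrier v)
  map a := (M.map a).restrict (A.map_mem a)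

/-- The quotient `B / A`, for submodules `A ⊆ B` of `M`, with `(B / A)(v) = B(v) / A(v)`. -/
def quotient (B A : M.Sub) : QuiverModule R where
  obj v := ModuleCat.of (R.obj v) (B.carrier v ⧸ (A.carrier v).submoduleOf (B.carrier v))
  map {v w} a :=
    Submodule.mapQ ((A.carrier v).submoduleOf (B.carrier v))
      ((A.carrier w).submoduleOf (B.carrier w)) ((M.map a).restrict (B.map_mem a))
      fun x hx => A.map_mem a x.1 hx

end Sub

/-- `(A α | α ≤ μ)` is a continuous chain of quasi-coherent submodules of `M`, starting at `0`
and ending at `M`. -/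
structure IsContinuousChain (M : QuiverModule R) (μ : Ordinal.{u})
    (A : Ordinal.{u} → M.Sub) : Prop where
  quasicoherent : ∀ α ≤ μ, (A α).toQuiverModule.IsQuasicoherent
  mono : ∀ α β, α ≤ β → β ≤ μ → ∀ v, (A α).carrier v ≤ (A β).carrier v
  zero : ∀ v, (A 0).carrier v = ⊥
  top : ∀ v, (A μ).carrier v = ⊤
  limit : ∀ α ≤ μ, Order.IsSuccLimit α → ∀ v,
    ((A α).carrier v : Set (M.obj v)) = ⋃ β < α, ((A β).carrier v : Set (M.obj v))

end Quiver

/-- The maps of `M` respect identities and compositions. -/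
def IsFunctorial {V : Type*} [Category V] {R : V ⥤ CommRingCat.{u}}
    (M : QuiverModule R.toPrefunctor) : Prop :=
  (∀ (v : V) (m : M.obj v), M.map (𝟙 v) m = m) ∧
    ∀ ⦃v w x : V⦄ (a : v ⟶ w) (b : w ⟶ x) (m : M.obj v), M.map (a ≫ b) m = M.map b (M.map a m)

end QuiverModule

namespace AlgebraicGeometry.Scheme

/-- A scheme with affine diagonal over `Spec ℤ`, the terminal scheme; equivalently, the
intersection of any two affine open subsets is affine. -/
abbrev IsSemiseparated (X : Scheme.{u}) : Prop :=
  IsAffineHom (Limits.pullback.diagonal (Limits.terminal.from X))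

/-- The vertices of the quiver of a cover `U 0, …, U n`: the non-empty subsets `v` of the
index set. They are ordered by inclusion, and there is a unique arrow `v ⟶ w` when `v ⊆ w`. -/
abbrev CoverVertex (n : ℕ) : Type := {v : Finset (Fin (n + 1)) // v.Nonempty}

/-- The representation `v ↦ 𝒪_X (⋂ k ∈ v, U k)` of the quiver of a cover, with the restriction
maps along the arrows. -/
def coverRepresentation (X : Scheme.{u}) {n : ℕ} (U : Fin (n + 1) → X.Opens) :
    CoverVertex n ⥤ CommRingCat.{u} where
  obj v := X.presheaf.obj (Opposite.op (v.1.inf U))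
  map {v w} a := X.presheaf.map (homOfLE (Finset.inf_mono (f := U) (leOfHom a))).op
  map_id v := X.presheaf.map_id _
  map_comp a b := by
    rw [← X.presheaf.map_comp]
    rfl

end AlgebraicGeometry.Scheme

/-!
The filtration exists over every quiver with countably many vertices and arrows, in particular over
the finite quiver of a cover (`QuiverModule.IsQuasicoherent.exists_isContinuousChain`).

An almost projective module `M` is a retract, through `s : M → E` and `g : E → M`, of a module
`E = F × (P →₀ R)` with `F` finitely generated. Let `y` be the generators of `E` given by finitely
many generators of `F` and the standard basis. If a set `J` of indices contains all generators of `F`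
or none, then `span (y '' J)` is a direct summand of `E`; if moreover `s ∘ g` maps it into itself,
then its image `span (g ∘ y '' J)` is a direct summand of `M`. Each index imposes only countably many
conditions of the form "some further index lies in `J`"
(`IsAlmostProjective.exists_generators`). So no decomposition of `M` into countably generated
summands is needed.

For a quasi-coherent `M`, take such generators at all vertices and let `J` be a set of indices at all
vertices. Requiring the spans to be stable under the maps of `M`, and each of them to be generated by
the image of the span at the source of any arrow, again imposes countably many conditions per
index (`QuiverModule.IsQuasicoherent.exists_closure_conditions`). For a closed `J` the spans are
direct summands of the `M(v)`, and so form a quasi-coherent submodule: base change preserves the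
split injection, without any flatness (`IsBaseChange.of_retract`). Quotients of two such submodules
are quasi-coherent by right exactness (`IsBaseChange.quotient`), and are at each vertex again
direct summands of `M(v)`, hence almost projective
(`IsAlmostProjective.quotient_of_retract`).

Closed sets are stable under unions, and each index lies in a countable closed set. Well-ordering the
indices and adding these countable sets one at a time gives a continuous chain of closed sets whose
successive differences are countable (`exists_continuous_chain_of_closed_sets`), and the spans of
its terms form the required filtration.
-/

/-! ### Retracts and generators of almost projective modules -/

section Modules

variable {R : Type u} [CommRing R] {M N : Type u} [AddCommGroup M] [Module R M]
  [AddCommGroup N] [Module R N]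

theorem IsAlmostProjective.of_retract (hM : IsAlmostProjective R M) (s : N →ₗ[R] M)
    (g : M →ₗ[R] N) (hgs : ∀ n, g (s n) = n) : IsAlmostProjective R N := by
  obtain ⟨E, K, _, _, _, _, hE, ⟨e⟩⟩ := hM
  let f : M ≃ₗ[R] N × LinearMap.ker g :=
    { toFun := fun m => (g m, ⟨m - s (g m), by simp [hgs]⟩)
      map_add' := fun a b => by ext <;> simp [add_sub_add_comm]
      map_smul' := fun r a => by ext <;> simp [smul_sub]
      invFun := fun y => s y.1 + y.2
      left_inv := fun m => by simp
      right_inv := fun y => by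
        have := LinearMap.mem_ker.1 y.2.2
        ext <;> simp [hgs, this] }
  exact ⟨E, LinearMap.ker g × K, _, _, _, _, hE,
    ⟨e ≪≫ₗ (f.prodCongr (.refl R K)) ≪≫ₗ .prodAssoc R N (LinearMap.ker g) K⟩⟩

theorem Submodule.exists_finite_mem_span_image {ι A B : Type*} [CommRing A]
    [AddCommGroup B] [Module A B] (x : ι → B) {b : B} (hb : b ∈ Submodule.span A (Set.range x)) :
    ∃ t : Set ι, t.Finite ∧ b ∈ Submodule.span A (x '' t) := by
  obtain ⟨l, rfl⟩ := Finsupp.mem_span_range_iff_exists_finsupp.1 hb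
  exact ⟨l.support, l.support.finite_toSet, Submodule.sum_mem _ fun i hi =>
    Submodule.smul_mem _ _ (Submodule.subset_span ⟨i, hi, rfl⟩)⟩

theorem LinearMap.apply_eq_self_of_mem_span {X : Set M} {p : M →ₗ[R] M} (hp : ∀ x ∈ X, p x = x)
    {m : M} (hm : m ∈ Submodule.span R X) : p m = m :=
  LinearMap.eqOn_span (g := LinearMap.id) hp hm

/-- The generators of `F × (P →₀ R)` obtained from a family `f` in `F` and from the standard basis
of `P →₀ R`. -/
noncomputable def prodFinsuppGenerators (R : Type*) [CommRing R] {F κ : Type*} (P : Type*)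
    [AddCommGroup F] (f : κ → F) : κ ⊕ P → F × (P →₀ R) :=
  Sum.elim (fun k => (f k, 0)) (fun a => (0, Finsupp.single a 1))

section

variable {F P κ : Type*} [AddCommGroup F] [Module R F] {f : κ → F}

theorem span_range_prodFinsuppGenerators (hf : Submodule.span R (Set.range f) = ⊤) :
    Submodule.span R (Set.range (prodFinsuppGenerators R P f)) = ⊤ := by
  have h1 : (⊤ : Submodule R F) ≤
      (Submodule.span R (Set.range (prodFinsuppGenerators R P f))).comap
        (LinearMap.inl R F (P →₀ R)) := by
    rw [← hf, Submodule.span_le]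
    rintro _ ⟨k, rfl⟩
    exact Submodule.subset_span ⟨Sum.inl k, rfl⟩
  have h2 : (⊤ : Submodule R (P →₀ R)) ≤
      (Submodule.span R (Set.range (prodFinsuppGenerators R P f))).comap
        (LinearMap.inr R F (P →₀ R)) := by
    rw [← Finsupp.basisSingleOne.span_eq, Submodule.span_le]
    rintro _ ⟨a, rfl⟩
    exact Submodule.subset_span ⟨Sum.inr a, by simp [prodFinsuppGenerators]⟩
  refine top_unique fun m _ => ?_
  have hm1 := h1 (Submodule.mem_top (x := m.1))
  have hm2 := h2 (Submodule.mem_top (x := m.2))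
  simpa using add_mem (Submodule.mem_comap.1 hm1) (Submodule.mem_comap.1 hm2)

/-- A set `J` of the standard generators of `F × (P →₀ R)` that contains all generators of `F` or
none of them spans a direct summand. -/
theorem exists_retraction_span_prodFinsuppGenerators
    (hf : Submodule.span R (Set.range f) = ⊤) (J : Set (κ ⊕ P))
    (hJ : ∀ k, Sum.inl k ∈ J → ∀ l, Sum.inl l ∈ J) :
    ∃ p : F × (P →₀ R) →ₗ[R] F × (P →₀ R),
      (∀ m, p m ∈ Submodule.span R (prodFinsuppGenerators R P f '' J)) ∧
      ∀ j ∈ J, p (prodFinsuppGenerators R P f j) = prodFinsuppGenerators R P f j := by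
  classical
  let pF : F →ₗ[R] F := if ∃ k, Sum.inl k ∈ J then LinearMap.id else 0
  let pP : (P →₀ R) →ₗ[R] (P →₀ R) :=
    Finsupp.linearCombination R fun a => if Sum.inr a ∈ J then Finsupp.single a 1 else 0
  have hfix : ∀ j ∈ J, pF.prodMap pP (prodFinsuppGenerators R P f j) =
      prodFinsuppGenerators R P f j := by
    rintro (k | a) hj
    · have : pF = LinearMap.id := if_pos ⟨k, hj⟩
      simp [prodFinsuppGenerators, this]
    · simp [prodFinsuppGenerators, pP, hj]
  refine ⟨pF.prodMap pP, fun m => ?_, hfix⟩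
  have hspan : Submodule.span R (Set.range (prodFinsuppGenerators R P f)) ≤
      (Submodule.span R (prodFinsuppGenerators R P f '' J)).comap (pF.prodMap pP) := by
    rw [Submodule.span_le]
    rintro _ ⟨i, rfl⟩
    by_cases hi : i ∈ J
    · exact Submodule.mem_comap.2 ((hfix i hi).symm ▸ Submodule.subset_span ⟨i, hi, rfl⟩)
    · have : pF.prodMap pP (prodFinsuppGenerators R P f i) = 0 := by
        rcases i with k | a
        · have : pF = 0 := if_neg fun ⟨l, hl⟩ => hi (hJ l hl k)
          simp [prodFinsuppGenerators, this]
        · simp [prodFinsuppGenerators, pP, hi]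
      exact Submodule.mem_comap.2 (this ▸ zero_mem _)
  exact hspan (span_range_prodFinsuppGenerators (P := P) hf ▸ Submodule.mem_top)

end

/-- An almost projective module has generators `x i`, with countably many closure conditions
`c i` for each index, such that every `c`-closed set of indices spans a direct summand. -/
theorem IsAlmostProjective.exists_generators (hM : IsAlmostProjective R M) :
    ∃ (I : Type u) (x : I → M) (c : I → Set I), (∀ i, (c i).Countable) ∧
      Submodule.span R (Set.range x) = ⊤ ∧
      ∀ J : Set I, (∀ i ∈ J, c i ⊆ J) → ∃ p : M →ₗ[R] M,
        (∀ m, p m ∈ Submodule.span R (x '' J)) ∧ ∀ m ∈ Submodule.span R (x '' J), p m = m := by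
  obtain ⟨E, K, _, _, _, _, ⟨P, F, _, _, _, _, _, hF, ⟨e'⟩⟩, ⟨e⟩⟩ := hM
  obtain ⟨σ, hσ⟩ := Module.projective_def.1 ‹Module.Projective R P›
  obtain ⟨n, f, hf⟩ := Module.Finite.exists_fin (R := R) (M := F)
  -- `M` is a retract of `F × (P →₀ R)`
  let s : M →ₗ[R] F × (P →₀ R) :=
    LinearMap.prodMap LinearMap.id σ ∘ₗ (LinearEquiv.prodComm R P F).toLinearMap ∘ₗ
      e'.toLinearMap ∘ₗ e.symm.toLinearMap ∘ₗ LinearMap.inl R M K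
  let g : F × (P →₀ R) →ₗ[R] M :=
    LinearMap.fst R M K ∘ₗ e.toLinearMap ∘ₗ e'.symm.toLinearMap ∘ₗ
      (LinearEquiv.prodComm R P F).symm.toLinearMap ∘ₗ
      LinearMap.prodMap LinearMap.id (Finsupp.linearCombination R id)
  have hgs : ∀ m, g (s m) = m := fun m => by
    have h : (LinearMap.prodMap LinearMap.id (Finsupp.linearCombination R id))
        (LinearMap.prodMap LinearMap.id σ ((LinearEquiv.prodComm R P F) (e' (e.symm (m, 0))))) =
        (LinearEquiv.prodComm R P F) (e' (e.symm (m, 0))) := Prod.ext rfl (hσ _)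
    change (e (e'.symm ((LinearEquiv.prodComm R P F).symm _))).1 = m
    erw [h]
    simp
  let y : Fin n ⊕ P → F × (P →₀ R) := prodFinsuppGenerators R P f
  have hy : Submodule.span R (Set.range y) = ⊤ := span_range_prodFinsuppGenerators hf
  -- The sets `t i` make `s ∘ g` preserve the span of a closed set of generators; the other part of
  -- the closure conditions treats the generators of `F` as a single block.
  choose t ht hst using fun i => Submodule.exists_finite_mem_span_image (A := R) y
    (b := s (g (y i))) (hy ▸ Submodule.mem_top)
  refine ⟨Fin n ⊕ P, g ∘ y, fun i => t i ∪ {j | i.isLeft ∧ j.isLeft}, fun i => ?_, ?_,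
    fun J hJ => ?_⟩
  · refine (ht i).countable.union ?_
    refine (Set.countable_range (Sum.inl : Fin n → Fin n ⊕ P)).mono ?_
    rintro (k | a) ⟨-, h⟩
    · exact ⟨k, rfl⟩
    · simp at h
  · rw [Set.range_comp, ← Submodule.map_span, hy, Submodule.map_top, LinearMap.range_eq_top]
    exact fun m => ⟨s m, hgs m⟩
  · obtain ⟨p, hp, hp'⟩ := exists_retraction_span_prodFinsuppGenerators (P := P) hf J
      fun k hk l => hJ _ hk (Or.inr ⟨rfl, rfl⟩)
    refine ⟨g ∘ₗ p ∘ₗ s, fun m => ?_, fun m hm => LinearMap.apply_eq_self_of_mem_span ?_ hm⟩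
    · rw [Set.image_comp, ← Submodule.map_span]
      exact Submodule.mem_map_of_mem (hp _)
    · rintro _ ⟨j, hj, rfl⟩
      have hsj : s (g (y j)) ∈ Submodule.span R (y '' J) :=
        Submodule.span_mono (Set.image_mono fun i hi => hJ j hj (Or.inl hi)) (hst j)
      have := LinearMap.apply_eq_self_of_mem_span (p := p)
        (by rintro _ ⟨j, hj, rfl⟩; exact hp' j hj) hsj
      simp [this, hgs]

end Modules

/-! ### Chains of closed sets -/

section Closure

variable {K : Type u}

theorem exists_countable_closed_superset (C : K → Set K) (hC : ∀ i, (C i).Countable) (i : K) :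
    ∃ D : Set K, i ∈ D ∧ D.Countable ∧ ∀ j ∈ D, C j ⊆ D := by
  let A : ℕ → Set K := fun n => Nat.rec {i} (fun _ S => ⋃ j ∈ S, C j) n
  refine ⟨⋃ n, A n, Set.mem_iUnion.2 ⟨0, rfl⟩, Set.countable_iUnion fun n => ?_,
    fun j hj k hk => ?_⟩
  · induction n with
    | zero => exact Set.countable_singleton i
    | succ n ih => exact ih.biUnion fun j _ => hC j
  · obtain ⟨n, hn⟩ := Set.mem_iUnion.1 hj
    exact Set.mem_iUnion.2 ⟨n + 1, Set.mem_biUnion hn hk⟩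

/-- If every index requires countably many further ones, then the whole index set is the union of
a continuous well-ordered chain of closed sets with countable successive differences. -/
theorem exists_continuous_chain_of_closed_sets (C : K → Set K) (hC : ∀ i, (C i).Countable) :
    ∃ (μ : Ordinal.{u}) (J : Ordinal.{u} → Set K),
      (∀ α, ∀ i ∈ J α, C i ⊆ J α) ∧ Monotone J ∧ J 0 = ∅ ∧ J μ = Set.univ ∧
      (∀ α, Order.IsSuccLimit α → J α = ⋃ β < α, J β) ∧
      ∀ α, (J (Order.succ α) \ J α).Countable := by
  choose D hiD hDc hD using exists_countable_closed_superset C hC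
  let r : K → K → Prop := WellOrderingRel
  have mem {α i} : (i ∈ ⋃ (k : K) (_ : Ordinal.typein r k < α), D k) ↔
      ∃ k, Ordinal.typein r k < α ∧ i ∈ D k := by simp
  refine ⟨Ordinal.type r, fun α => ⋃ (k : K) (_ : Ordinal.typein r k < α), D k,
    fun α i hi j hj => ?_, fun α β h i hi => ?_, ?_, ?_, fun α hα => ?_, fun α => ?_⟩
  · obtain ⟨k, hk, hik⟩ := mem.1 hi
    exact mem.2 ⟨k, hk, hD k i hik hj⟩
  · obtain ⟨k, hk, hik⟩ := mem.1 hi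
    exact mem.2 ⟨k, hk.trans_le h, hik⟩
  · simp
  · exact Set.eq_univ_of_forall fun i => mem.2 ⟨i, Ordinal.typein_lt_type r i, hiD i⟩
  · ext i
    simp only [mem, Set.mem_iUnion, exists_prop]
    constructor
    · rintro ⟨k, hk, hik⟩
      exact ⟨_, hα.succ_lt hk, k, Order.lt_succ _, hik⟩
    · rintro ⟨β, hβ, k, hk, hik⟩
      exact ⟨k, hk.trans hβ, hik⟩
  · have hs : {k | Ordinal.typein r k = α}.Subsingleton := fun k hk l hl =>
      Ordinal.typein_injective r (hk.trans hl.symm)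
    refine (hs.countable.biUnion fun k _ => hDc k).mono fun i hi => ?_
    obtain ⟨k, hk, hik⟩ := mem.1 hi.1
    rcases (Order.lt_succ_iff.1 hk).lt_or_eq with h | h
    · exact (hi.2 (mem.2 ⟨k, h, hik⟩)).elim
    · exact Set.mem_biUnion h hik

end Closure

/-! ### Base change of submodules and quotients -/

section BaseChange

variable {R S M N : Type u} [CommRing R] [CommRing S] [Algebra R S]
  [AddCommGroup M] [Module R M] [AddCommGroup N] [Module R N] [Module S N] [IsScalarTower R S N]

theorem IsBaseChange.span_image_eq_top {f : M →ₗ[R] N} (hf : IsBaseChange S f) {X : Set M}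
    (hX : Submodule.span R X = ⊤) : Submodule.span S (f '' X) = ⊤ := by
  refine top_unique fun n _ => ?_
  have hM : (⊤ : Submodule R M) ≤ ((Submodule.span S (f '' X)).restrictScalars R).comap f := by
    rw [← hX, Submodule.span_le]
    exact fun m hm => Submodule.subset_span ⟨m, hm, rfl⟩
  induction n using hf.inductionOn with
  | zero => exact zero_mem _
  | tmul m => exact hM (Submodule.mem_top (x := m))
  | smul s n h => exact Submodule.smul_mem _ s (h trivial)
  | add m n hm hn => exact add_mem (hm trivial) (hn trivial)

/-- A direct summand `A` of `M` is base changed to the submodule of `N` generated by its image. -/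
theorem IsBaseChange.of_retract {f : M →ₗ[R] N} (hf : IsBaseChange S f)
    {A : Submodule R M} {B : Submodule S N}
    (p : M →ₗ[R] M) (hp : ∀ m, p m ∈ A) (hpA : ∀ m ∈ A, p m = m)
    (hB : B ≤ Submodule.span S (f '' A)) (g : A →ₗ[R] B) (hg : ∀ a, (g a : N) = f a) :
    IsBaseChange S g := by
  have hspan : Submodule.span S (Set.range g) = ⊤ := by
    refine Submodule.map_injective_of_injective B.injective_subtype ?_
    rw [Submodule.map_span, Submodule.map_subtype_top]
    refine le_antisymm ?_ (hB.trans (Submodule.span_mono ?_))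
    · rw [Submodule.span_le]
      rintro _ ⟨b, -, rfl⟩
      exact b.2
    · rintro _ ⟨a, ha, rfl⟩
      exact ⟨g ⟨a, ha⟩, ⟨_, rfl⟩, hg _⟩
  refine IsBaseChange.of_lift_unique g fun Q _ _ _ _ q => ?_
  refine ⟨hf.lift (q ∘ₗ p.codRestrict A hp) ∘ₗ B.subtype, ?_, fun q' hq' => ?_⟩
  · ext a
    have : p.codRestrict A hp a = a := Subtype.ext (hpA a a.2)
    simp [hg, hf.lift_eq, this]
  · refine LinearMap.ext_on hspan ?_
    rintro _ ⟨a, rfl⟩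
    have : p.codRestrict A hp a = a := Subtype.ext (hpA a a.2)
    have h := LinearMap.congr_fun hq' a
    simpa [hg, hf.lift_eq, this] using h

/-- Right exactness of base change. -/
theorem IsBaseChange.quotient {f : M →ₗ[R] N} (hf : IsBaseChange S f)
    {A : Submodule R M} {B : Submodule S N}
    (hB : B ≤ Submodule.span S (f '' A)) (g : M ⧸ A →ₗ[R] N ⧸ B)
    (hg : ∀ m, g (A.mkQ m) = B.mkQ (f m)) : IsBaseChange S g := by
  refine IsBaseChange.of_lift_unique g fun Q _ _ _ _ q => ?_
  -- The universal property quantifies over additive monoids, but `Submodule.liftQ` wants a group.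
  let : AddCommGroup Q := Module.addCommMonoidToAddCommGroup S
  have hBker : B ≤ LinearMap.ker (hf.lift (q ∘ₗ A.mkQ)) := by
    refine hB.trans (Submodule.span_le.2 ?_)
    rintro _ ⟨a, ha, rfl⟩
    have : A.mkQ a = 0 := (Submodule.Quotient.mk_eq_zero A).2 ha
    simp [hf.lift_eq, this]
  refine ⟨B.liftQ _ hBker, ?_, fun q' hq' => ?_⟩
  · ext m
    have := hg m
    simp at this
    simp [this, hf.lift_eq]
  · refine Submodule.linearMap_qext _ (hf.algHom_ext _ _ fun m => ?_)
    have h := LinearMap.congr_fun hq' (A.mkQ m)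
    have := hg m
    simp at this
    simpa [this, hf.lift_eq] using h

end BaseChange

/-! ### Quasi-coherence and functoriality of submodules and quotients -/

namespace QuiverModule

variable {V : Type*} [Quiver V] {R : V ⥤q CommRingCat.{u}} {M : QuiverModule R}

theorem IsQuasicoherent.span_image_eq_top (hM : M.IsQuasicoherent) {v w : V} (a : v ⟶ w)
    {X : Set (M.obj v)} (hX : Submodule.span (R.obj v) X = ⊤) :
    Submodule.span (R.obj w) (M.map a '' X) = ⊤ := by
  let : Algebra (R.obj v) (R.obj w) := (R.map a).hom.toAlgebra
  let : Module (R.obj v) (M.obj w) := Module.compHom (M.obj w) (R.map a).hom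
  have : IsScalarTower (R.obj v) (R.obj w) (M.obj w) :=
    IsScalarTower.of_algebraMap_smul fun _ _ => rfl
  exact (hM a).span_image_eq_top hX

namespace Sub

theorem isQuasicoherent_toQuiverModule (hM : M.IsQuasicoherent) (A : M.Sub)
    (hA : ∀ ⦃v w : V⦄ (a : v ⟶ w),
      A.carrier w ≤ Submodule.span (R.obj w) (M.map a '' A.carrier v))
    (hp : ∀ v, ∃ p : M.obj v →ₗ[R.obj v] M.obj v,
      (∀ m, p m ∈ A.carrier v) ∧ ∀ m ∈ A.carrier v, p m = m) :
    A.toQuiverModule.IsQuasicoherent := by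
  intro v w a
  obtain ⟨p, hp, hpA⟩ := hp v
  let : Algebra (R.obj v) (R.obj w) := (R.map a).hom.toAlgebra
  let : Module (R.obj v) (M.obj w) := Module.compHom (M.obj w) (R.map a).hom
  have : IsScalarTower (R.obj v) (R.obj w) (M.obj w) :=
    IsScalarTower.of_algebraMap_smul fun _ _ => rfl
  exact (hM a).of_retract p hp hpA (hA a)
    { toFun := (M.map a).restrict (A.map_mem a)
      map_add' := map_add _
      map_smul' := fun r x => ((M.map a).restrict (A.map_mem a)).map_smulₛₗ r x } fun _ => rfl

theorem isQuasicoherent_quotient {A B : M.Sub} (hB : B.toQuiverModule.IsQuasicoherent)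
    (hAB : ∀ v, A.carrier v ≤ B.carrier v)
    (hA : ∀ ⦃v w : V⦄ (a : v ⟶ w),
      A.carrier w ≤ Submodule.span (R.obj w) (M.map a '' A.carrier v)) :
    (B.quotient A).IsQuasicoherent := by
  intro v w a
  let : Algebra (R.obj v) (R.obj w) := (R.map a).hom.toAlgebra
  let : Module (R.obj v) (M.obj w) := Module.compHom (M.obj w) (R.map a).hom
  have : IsScalarTower (R.obj v) (R.obj w) (M.obj w) :=
    IsScalarTower.of_algebraMap_smul fun _ _ => rfl
  let f : B.carrier v →ₗ[R.obj v] B.carrier w :=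
    { toFun := (M.map a).restrict (B.map_mem a)
      map_add' := map_add _
      map_smul' := fun r x => ((M.map a).restrict (B.map_mem a)).map_smulₛₗ r x }
  let g : (B.carrier v ⧸ (A.carrier v).submoduleOf (B.carrier v)) →ₗ[R.obj v]
      (B.carrier w ⧸ (A.carrier w).submoduleOf (B.carrier w)) :=
    { toFun := (B.quotient A).map a
      map_add' := ((B.quotient A).map a).map_add
      map_smul' := fun r x => ((B.quotient A).map a).map_smulₛₗ r x }
  have hf : IsBaseChange (R.obj w) f := hB a
  refine hf.quotient (A := (A.carrier v).submoduleOf (B.carrier v))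
    (B := (A.carrier w).submoduleOf (B.carrier w)) ?_ g fun _ => rfl
  rintro ⟨x, hxB⟩ (hx : x ∈ A.carrier w)
  have : (Submodule.span (R.obj w) (f ''
      (A.carrier v).submoduleOf (B.carrier v))).map (B.carrier w).subtype =
      Submodule.span (R.obj w) (M.map a '' A.carrier v) := by
    rw [Submodule.map_span]
    congr 1
    ext y
    constructor
    · rintro ⟨_, ⟨b, hb, rfl⟩, rfl⟩
      exact ⟨b.1, hb, rfl⟩
    · rintro ⟨b, hb, rfl⟩
      exact ⟨_, ⟨⟨b, hAB v hb⟩, hb, rfl⟩, rfl⟩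
  obtain ⟨z, hz, rfl⟩ := this.ge (hA a hx)
  exact hz

theorem isFunctorial_toQuiverModule {V : Type*} [Category V] {R : V ⥤ CommRingCat.{u}}
    {M : QuiverModule R.toPrefunctor} (hM : M.IsFunctorial) (A : M.Sub) :
    A.toQuiverModule.IsFunctorial :=
  ⟨fun v m => Subtype.ext (hM.1 v m.1), fun _ _ _ a b m => Subtype.ext (hM.2 a b m.1)⟩

theorem isFunctorial_quotient {V : Type*} [Category V] {R : V ⥤ CommRingCat.{u}}
    {M : QuiverModule R.toPrefunctor} (hM : M.IsFunctorial) (B A : M.Sub) :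
    (B.quotient A).IsFunctorial := by
  have hB := isFunctorial_toQuiverModule hM B
  refine ⟨fun v m => ?_, fun v w x a b m => ?_⟩
  · obtain ⟨m, rfl⟩ := Submodule.Quotient.mk_surjective _ m
    exact congrArg (Submodule.Quotient.mk) (hB.1 v m)
  · obtain ⟨m, rfl⟩ := Submodule.Quotient.mk_surjective _ m
    exact congrArg (Submodule.Quotient.mk) (hB.2 a b m)

end Sub

end QuiverModule

/-! ### Quotients of direct summands -/

section Quotient

variable {R : Type u} [CommRing R] {M : Type u} [AddCommGroup M] [Module R M]

theorem IsAlmostProjective.quotient_of_retract (hM : IsAlmostProjective R M) {A B : Submodule R M}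
    (hA : ∃ p : M →ₗ[R] M, (∀ m, p m ∈ A) ∧ ∀ m ∈ A, p m = m)
    (hB : ∃ p : M →ₗ[R] M, (∀ m, p m ∈ B) ∧ ∀ m ∈ B, p m = m) (hAB : A ≤ B) :
    IsAlmostProjective R (B ⧸ A.submoduleOf B) := by
  obtain ⟨p, hp, hpA⟩ := hA
  obtain ⟨q, hq, hqB⟩ := hB
  refine hM.of_retract
    ((A.submoduleOf B).liftQ ((LinearMap.id - p) ∘ₗ B.subtype) fun b hb => ?_)
    ((A.submoduleOf B).mkQ ∘ₗ q.codRestrict B hq) fun n => ?_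
  · simp [hpA _ (show (b : M) ∈ A from hb)]
  · obtain ⟨b, rfl⟩ := Submodule.Quotient.mk_surjective _ n
    refine (Submodule.Quotient.eq _).2 ?_
    change q ((b : M) - p b) - (b : M) ∈ A
    rw [hqB _ (sub_mem b.2 (hAB (hp b)))]
    simpa using hp b

theorem isCountablyGeneratedModule_quotient {A B : Submodule R M} {X : Set M}
    (hX : X.Countable) (hXB : X ⊆ B) (hB : B ≤ A ⊔ Submodule.span R X) :
    IsCountablyGeneratedModule R (B ⧸ A.submoduleOf B) := by
  refine ⟨(A.submoduleOf B).mkQ '' ((↑) ⁻¹' X),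
    (hX.preimage Subtype.val_injective).image _, top_unique fun n _ => ?_⟩
  obtain ⟨b, rfl⟩ := Submodule.Quotient.mk_surjective _ n
  obtain ⟨a, ha, y, hy, hay⟩ := Submodule.mem_sup.1 (hB b.2)
  have hspan : Submodule.span R X = (Submodule.span R ((↑) ⁻¹' X : Set B)).map B.subtype := by
    rw [Submodule.map_span]
    congr 1
    exact (Set.image_preimage_eq_of_subset (by simpa using hXB)).symm
  obtain ⟨y, hy', rfl⟩ := hspan.le hy
  rw [← Submodule.map_span]
  refine ⟨y, hy', (Submodule.Quotient.eq _).2 ?_⟩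
  change (y : M) - (b : M) ∈ A
  rw [← hay]
  simpa using ha

end Quotient

/-! ### The filtration -/

namespace QuiverModule

variable {V : Type} [Quiver V] {R : V ⥤q CommRingCat.{u}} {M : QuiverModule R}

section SpanOf

variable {I : V → Type u} (x : ∀ v, I v → M.obj v)

/-- The span of the generators at the vertex `v` whose indices lie in `J`. -/
def spanAt (J : Set (Σ v, I v)) (v : V) : Submodule (R.obj v) (M.obj v) :=
  Submodule.span (R.obj v) (x v '' (Sigma.mk v ⁻¹' J))

theorem spanAt_mono {J J' : Set (Σ v, I v)} (h : J ⊆ J') (v : V) :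
    spanAt x J v ≤ spanAt x J' v :=
  Submodule.span_mono (Set.image_mono (Set.preimage_mono h))

theorem mem_spanAt_biUnion {J : Ordinal.{u} → Set (Σ v, I v)} (hJ : Monotone J) {α : Ordinal.{u}}
    (hα : Order.IsSuccLimit α) {v : V} {m : M.obj v}
    (hm : m ∈ spanAt x (⋃ β < α, J β) v) : ∃ β < α, m ∈ spanAt x (J β) v := by
  have : Nonempty (Set.Iio α) := ⟨⟨0, hα.bot_lt⟩⟩
  have hle : spanAt x (⋃ β < α, J β) v ≤ ⨆ β : Set.Iio α, spanAt x (J β) v := by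
    refine Submodule.span_le.2 ?_
    rintro _ ⟨i, hi, rfl⟩
    obtain ⟨β, hβ, hi⟩ := Set.mem_iUnion₂.1 hi
    exact Submodule.mem_iSup_of_mem ⟨β, hβ⟩ (Submodule.subset_span ⟨i, hi, rfl⟩)
  obtain ⟨β, hβ⟩ := (Submodule.mem_iSup_of_directed
    (fun β : Set.Iio α => spanAt x (J β) v) (Monotone.directed_le fun β γ h => spanAt_mono x (hJ h) v)).1 (hle hm)
  exact ⟨β, β.2, hβ⟩

/-- The closure conditions on index sets, with countably many conditions for each index: a family
`C` such that for every `C`-closed set `J` the spans `spanAt x J` are stable under the maps of `M`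
and are generated by their images, and such that `J` is closed at each vertex with respect
to a given family `c`. -/
theorem IsQuasicoherent.exists_closure_conditions [Countable V] [∀ v w : V, Countable (v ⟶ w)]
    (hM : M.IsQuasicoherent) (hx : ∀ v, Submodule.span (R.obj v) (Set.range (x v)) = ⊤)
    (c : ∀ v, I v → Set (I v)) (hc : ∀ v i, (c v i).Countable) :
    ∃ C : (Σ v, I v) → Set (Σ v, I v), (∀ i, (C i).Countable) ∧
      ∀ J : Set (Σ v, I v), (∀ i ∈ J, C i ⊆ J) →
        (∀ v, ∀ i ∈ Sigma.mk v ⁻¹' J, c v i ⊆ Sigma.mk v ⁻¹' J) ∧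
        ∀ ⦃v w : V⦄ (a : v ⟶ w), (∀ m ∈ spanAt x J v, M.map a m ∈ spanAt x J w) ∧
          spanAt x J w ≤ Submodule.span (R.obj w) (M.map a '' spanAt x J v) := by
  -- The image of a generator along an arrow lies in the span of the generators in `T`; a generator
  -- lies in the span of the images, along an arrow into its vertex, of the generators in `S`.
  choose T hT hTx using fun (v w : V) (a : v ⟶ w) (i : I v) =>
    Submodule.exists_finite_mem_span_image (A := R.obj w) (x w) (b := M.map a (x v i))
      (hx w ▸ Submodule.mem_top)
  choose S hS hSx using fun (v w : V) (a : v ⟶ w) (i : I w) =>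
    Submodule.exists_finite_mem_span_image (A := R.obj w) (fun j => M.map a (x v j)) (b := x w i) (by
      have := hM.span_image_eq_top a (hx v)
      rw [← Set.range_comp] at this
      exact this ▸ Submodule.mem_top)
  refine ⟨fun i => Sigma.mk i.1 '' c i.1 i.2 ∪ ((⋃ w, ⋃ a, Sigma.mk w '' T i.1 w a i.2) ∪
    ⋃ v, ⋃ a, Sigma.mk v '' S v i.1 a i.2), fun i => ?_, fun J hJ => ⟨?_, fun v w a => ⟨?_, ?_⟩⟩⟩
  · exact ((hc _ _).image _).union
      ((Set.countable_iUnion fun w => Set.countable_iUnion fun a =>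
          (hT _ _ _ _).countable.image _).union
        (Set.countable_iUnion fun v => Set.countable_iUnion fun a =>
          (hS _ _ _ _).countable.image _))
  · exact fun v i hi j hj => hJ _ hi (Or.inl ⟨j, hj, rfl⟩)
  · have : spanAt x J v ≤ (spanAt x J w).comap (M.map a) := by
      refine Submodule.span_le.2 ?_
      rintro _ ⟨i, hi, rfl⟩
      have hTJ : T v w a i ⊆ Sigma.mk w ⁻¹' J := fun j hj =>
        hJ _ hi (Or.inr (Or.inl (Set.mem_iUnion₂.2 ⟨w, a, Set.mem_image_of_mem _ hj⟩)))
      exact Submodule.span_mono (Set.image_mono hTJ) (hTx v w a i)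
    exact this
  · refine Submodule.span_le.2 ?_
    rintro _ ⟨i, hi, rfl⟩
    have hSJ : S v w a i ⊆ Sigma.mk v ⁻¹' J := fun j hj =>
      hJ _ hi (Or.inr (Or.inr (Set.mem_iUnion₂.2 ⟨v, a, Set.mem_image_of_mem _ hj⟩)))
    refine Submodule.span_mono ?_ (hSx v w a i)
    rintro _ ⟨j, hj, rfl⟩
    exact Set.mem_image_of_mem _ (Submodule.subset_span (Set.mem_image_of_mem _ (hSJ hj)))

end SpanOf

/-- The filtration, over any representation of a quiver with countably many vertices and arrows. -/
theorem IsQuasicoherent.exists_isContinuousChain [Countable V] [∀ v w : V, Countable (v ⟶ w)]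
    (hqc : M.IsQuasicoherent) (hap : M.IsLocallyAlmostProjective) :
    ∃ (μ : Ordinal.{u}) (A : Ordinal.{u} → M.Sub),
      M.IsContinuousChain μ A ∧
      ∀ α < μ,
        ((A (Order.succ α)).quotient (A α)).IsQuasicoherent ∧
        ((A (Order.succ α)).quotient (A α)).IsLocallyCountablyGenerated ∧
        ((A (Order.succ α)).quotient (A α)).IsLocallyAlmostProjective := by
  choose I x c hc hx hret using fun v => (hap v).exists_generators
  obtain ⟨C, hC, hCJ⟩ := hqc.exists_closure_conditions x hx c hc
  obtain ⟨μ, J, hJ, hmono, hzero, htop, hlim, hsucc⟩ := exists_continuous_chain_of_closed_sets C hC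
  let A : Ordinal.{u} → M.Sub := fun α =>
    { carrier := spanAt x (J α)
      map_mem := fun a => ((hCJ _ (hJ α)).2 a).1 }
  have hspan : ∀ α ⦃v w : V⦄ (a : v ⟶ w),
      (A α).carrier w ≤ Submodule.span (R.obj w) (M.map a '' (A α).carrier v) :=
    fun α v w a => ((hCJ _ (hJ α)).2 a).2
  have hA : ∀ α v, ∃ p : M.obj v →ₗ[R.obj v] M.obj v,
      (∀ m, p m ∈ (A α).carrier v) ∧ ∀ m ∈ (A α).carrier v, p m = m :=
    fun α v => hret v _ ((hCJ _ (hJ α)).1 v)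
  have hle : ∀ {α β}, α ≤ β → ∀ v, (A α).carrier v ≤ (A β).carrier v :=
    fun h v => spanAt_mono x (hmono h) v
  have hAqc : ∀ α, (A α).toQuiverModule.IsQuasicoherent := fun α =>
    (A α).isQuasicoherent_toQuiverModule hqc (hspan α) (hA α)
  refine ⟨μ, A, ⟨fun α _ => hAqc α, fun α β h _ => hle h, fun v => ?_, fun v => ?_,
    fun α _ hα v => ?_⟩, fun α _ => ⟨?_, fun v => ?_, fun v => ?_⟩⟩
  · simp [A, spanAt, hzero]
  · simp [A, spanAt, htop, hx]
  · refine Set.Subset.antisymm (fun m hm => ?_) (Set.iUnion₂_subset fun β hβ => hle hβ.le v)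
    obtain ⟨β, hβ, hm⟩ := mem_spanAt_biUnion x hmono hα (by rwa [← hlim α hα])
    exact Set.mem_iUnion₂.2 ⟨β, hβ, hm⟩
  · exact Sub.isQuasicoherent_quotient (hAqc _) (hle (Order.le_succ α)) (hspan α)
  · refine isCountablyGeneratedModule_quotient
      (X := x v '' (Sigma.mk v ⁻¹' (J (Order.succ α) \ J α)))
      (((hsucc α).preimage sigma_mk_injective).image _) ?_ ?_
    · exact (Set.image_mono fun i hi => hi.1).trans Submodule.subset_span
    · refine Submodule.span_le.2 ?_
      rintro _ ⟨i, hi, rfl⟩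
      by_cases h : (⟨v, i⟩ : Σ v, I v) ∈ J α
      · exact Submodule.mem_sup_left (Submodule.subset_span ⟨i, h, rfl⟩)
      · exact Submodule.mem_sup_right (Submodule.subset_span ⟨i, ⟨hi, h⟩, rfl⟩)
  · exact (hap v).quotient_of_retract (hA α v) (hA _ v) (hle (Order.le_succ α) v)

end QuiverModule

open CategoryTheory AlgebraicGeometry in
theorem theorem4 (X : Scheme.{u}) [CompactSpace X] [X.IsSemiseparated]
    (n : ℕ) (U : Fin (n + 1) → X.Opens) (hU : ∀ i, IsAffineOpen (U i)) (hcover : ⨆ i, U i = ⊤)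
    (M : QuiverModule (X.coverRepresentation U).toPrefunctor)
    (hqc : M.IsQuasicoherent) (hap : M.IsLocallyAlmostProjective) :
    ∃ (μ : Ordinal.{u}) (A : Ordinal.{u} → M.Sub),
      M.IsContinuousChain μ A ∧
      (∀ α < μ,
        ((A (Order.succ α)).quotient (A α)).IsQuasicoherent ∧
        ((A (Order.succ α)).quotient (A α)).IsLocallyCountablyGenerated ∧
        ((A (Order.succ α)).quotient (A α)).IsLocallyAlmostProjective) ∧
      (M.IsFunctorial →
        (∀ α ≤ μ, (A α).toQuiverModule.IsFunctorial) ∧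
        ∀ α < μ, ((A (Order.succ α)).quotient (A α)).IsFunctorial) := by
  obtain ⟨μ, A, hA, hquot⟩ := hqc.exists_isContinuousChain hap
  exact ⟨μ, A, hA, hquot, fun hM => ⟨fun α _ => QuiverModule.Sub.isFunctorial_toQuiverModule hM (A α),
    fun α _ => QuiverModule.Sub.isFunctorial_quotient hM _ _⟩⟩
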